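/- Let $\mathcal O$ be a complete discrete valuation ring with uniformizer $\epsilon$, let $n\ge 2$ and $A=\mathcal O[X]/(X^n)$. An $A$-lattice is an $A$-module that is free of finite rank over $\mathcal O$. For $1\le i\le n-1$ let $Z_i=\{f\in A \mid X^i f\in \epsilon A\}$, that is, $$Z_i=\mathcal O\epsilon\oplus\mathcal O\epsilon X\oplus\cdots\oplus\mathcal O\epsilon X^{n-i-1}\oplus\mathcal O X^{n-i}\oplus\cdots\oplus\mathcal O X^{n-1}\subseteq A .$$ Let $\phi: Z_i\to Z_i$ be the $A$-linear map with $\phi(\epsilon)=X^{n-1}$ that sends every other basis element to $0$ (equivalently, $\phi(h)=X^{n-1}h/\epsilon$), let $\pi:A\oplus A\to Z_i$ be $\pi(f,g)=X^{n-i}f-\epsilon g$, and let $$E_i=\{(f,g,h)\in A\oplus A\oplus Z_i\mid \pi(f,g)=\phi(h)\}$$ be the pullback. The maps $Z_{n-i}\to E_i$, $f\mapsto (f,\,X^{n-i}f/\epsilon,\,0)$, and $E_i\to Z_i$, $(f,g,h)\mapsto h$, form a sequence $$0\to Z_{n-i}\to E_i\to Z_i\to 0 .$$ A short exact sequence $0\to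 L\to E\xrightarrow{p} M\to 0$ of $A$-lattices is called almost split if $p$ does not split, $L$ and $M$ are indecomposable, and for every indecomposable $A$-lattice $X$ the image of $\mathrm{Hom}_A(X,p)$ is $\mathrm{Rad}\,\mathrm{Hom}_A(X,M)$. Here $\mathrm{Rad}\,\mathrm{Hom}_A(M,N)$ consists of the $f\in \mathrm{Hom}_A(M,N)$ such that $hfg$ lies in the Jacobson radical of $\mathrm{End}_A(Y)$ for every indecomposable $A$-lattice $Y$ and all $g\in\mathrm{Hom}_A(Y,M)$, $h\in\mathrm{Hom}_A(N,Y)$. Then $0\to Z_{n-i}\to E_i\to Z_i\to 0$ is an almost split sequence of $A$-lattices for every $1\le i\le n-1$, and its middle term satisfies the following. 1. The regular module $A$ is an indecomposable direct summand of $E_1$. 2. For $2\le i\le n-1$, $E_i$ is an indecomposable $A$-lattice. -/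

import Mathlib

universe u

namespace HellerLattice

open Polynomial

section General

/-! Lattices over an `O`-algebra `A`, and almost split sequences of lattices. -/

/-- An `A`-lattice: an `A`-module that is free of finite rank as an `O`-module. -/
structure IsLattice (O M : Type*) [CommRing O] [AddCommGroup M] [Module O M] : Prop where
  free : Module.Free O M
  finite : Module.Finite O M

/-- Indecomposable modules: nonzero, and in every decomposition `M = P ⊕ Q` as an internal direct
sum of submodules one of the two summands is zero. -/
structure IsIndecomposable (A M : Type*) [Ring A] [AddCommGroup M] [Module A M] : Prop where
  nontrivial : Nontrivial M
  eq_bot_or_eq_bot : ∀ P Q : Submodule A M, IsCompl P Q → P = ⊥ ∨ Q = ⊥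

variable (O A : Type u) [CommRing O] [Ring A] [Algebra O A]

/-- `f : M → N` belongs to `Rad Hom_A(M, N)`: for every indecomposable `A`-lattice `X` and all
`g : X → M`, `h : N → X`, the composite `h f g` lies in the Jacobson radical of `End_A(X)`. -/
def IsRadicalHom {M N : Type u} [AddCommGroup M] [Module A M] [AddCommGroup N] [Module A N]
    (f : M →ₗ[A] N) : Prop :=
  ∀ (X : Type u) [AddCommGroup X] [Module O X] [Module A X] [IsScalarTower O A X],
    IsLattice O X → IsIndecomposable A X →
      ∀ (g : X →ₗ[A] M) (h : N →ₗ[A] X),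
        (h ∘ₗ f ∘ₗ g : Module.End A X) ∈ Ring.jacobson (Module.End A X)

/-- `0 → L → E → M → 0`, with maps `i : L → E` and `p : E → M`, is an almost split sequence of
`A`-lattices. -/
structure IsAlmostSplit {L E M : Type u}
    [AddCommGroup L] [Module O L] [Module A L] [IsScalarTower O A L]
    [AddCommGroup E] [Module O E] [Module A E] [IsScalarTower O A E]
    [AddCommGroup M] [Module O M] [Module A M] [IsScalarTower O A M]
    (i : L →ₗ[A] E) (p : E →ₗ[A] M) : Prop where
  lattice_left : IsLattice O L
  lattice_middle : IsLattice O E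
  lattice_right : IsLattice O M
  injective : Function.Injective i
  exact : Function.Exact i p
  surjective : Function.Surjective p
  not_split : ¬ ∃ s : M →ₗ[A] E, p ∘ₗ s = LinearMap.id
  indec_left : IsIndecomposable A L
  indec_right : IsIndecomposable A M
  /-- `Hom_A(X, E) → Hom_A(X, M)` has image `Rad Hom_A(X, M)`, for indecomposable lattices `X`. -/
  range_eq_radical : ∀ (X : Type u) [AddCommGroup X] [Module O X] [Module A X]
    [IsScalarTower O A X], IsLattice O X → IsIndecomposable A X →
      ∀ f : X →ₗ[A] M, (∃ q : X →ₗ[A] E, p ∘ₗ q = f) ↔ IsRadicalHom O A f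

end General

noncomputable section Truncated

variable {O : Type u} [CommRing O]

/-- The truncated polynomial ring `A = O[X]/(X^n)`. -/
abbrev Trunc (O : Type u) [CommRing O] (n : ℕ) : Type u := AdjoinRoot (X ^ n : O[X])

/-- The class of `X` in `A = O[X]/(X^n)`. -/
abbrev x (O : Type u) [CommRing O] (n : ℕ) : Trunc O n := AdjoinRoot.root (X ^ n : O[X])

/-- The class of `ε` in `A`. -/
abbrev eps (ε : O) (n : ℕ) : Trunc O n := algebraMap O (Trunc O n) ε

lemma x_pow_eq_zero (n : ℕ) : x O n ^ n = 0 := by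
  have h := AdjoinRoot.mk_self (f := (X ^ n : O[X]))
  rwa [map_pow, AdjoinRoot.mk_X] at h

lemma eps_mul_injective [IsDomain O] {ε : O} (hε : Irreducible ε) (n : ℕ) :
    Function.Injective (LinearMap.mulLeft (Trunc O n) (eps ε n)) := by
  have : Module.Free O (Trunc O n) := (monic_X_pow n).free_adjoinRoot
  intro a b hab
  simp only [LinearMap.mulLeft_apply, eps, ← Algebra.smul_def] at hab
  exact smul_right_injective _ hε.ne_zero hab

/-- The Heller lattice `Z_i`: the kernel of `A → A/εA`, `f ↦ X^i f + εA`. The image of this map,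
`(X^i A + εA)/εA`, is `M_i = κ[X]/(X^(n-i))`, and the map is its projective cover. As an
`O`-module `Z_i` has the basis `ε, εX, …, εX^(n-i-1), X^(n-i), …, X^(n-1)`. -/
def Z (ε : O) (n i : ℕ) : Submodule (Trunc O n) (Trunc O n) :=
  LinearMap.ker (x O n ^ i • Submodule.mkQ (Ideal.span {eps ε n}))

lemma mem_Z {ε : O} {n i : ℕ} {f : Trunc O n} : f ∈ Z ε n i ↔ eps ε n ∣ x O n ^ i * f := by
  rw [Z, LinearMap.mem_ker, LinearMap.smul_apply, ← map_smul, Submodule.mkQ_apply,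
    Submodule.Quotient.mk_eq_zero, smul_eq_mul, Ideal.mem_span_singleton]

lemma eps_mem_Z (ε : O) (n i : ℕ) : eps ε n ∈ Z ε n i := mem_Z.2 (Dvd.intro_left _ rfl)

/-- The map `π : A ⊕ A → Z_i ⊆ A`, `π(f, g) = X^(n-i) f - ε g`. -/
def proj (ε : O) (n i : ℕ) : (Trunc O n × Trunc O n) →ₗ[Trunc O n] Trunc O n :=
  x O n ^ (n - i) • LinearMap.fst _ _ _ - eps ε n • LinearMap.snd _ _ _

lemma proj_mem_Z (ε : O) {n i : ℕ} (hi : i ≤ n) (v : Trunc O n × Trunc O n) : proj ε n i v ∈ Z ε n i := by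
  have h : x O n ^ i * x O n ^ (n - i) = 0 := by
    rw [← pow_add, Nat.add_sub_cancel' hi, x_pow_eq_zero]
  refine mem_Z.2 ⟨-(x O n ^ i * v.2), ?_⟩
  simp only [proj, LinearMap.sub_apply, LinearMap.smul_apply, LinearMap.fst_apply,
    LinearMap.snd_apply, smul_eq_mul]
  linear_combination v.1 * h

variable [IsDomain O] {ε : O} (hε : Irreducible ε) (n i : ℕ)

/-- The map `Z_i → A`, `f ↦ X^i f / ε`. -/
def divEps : Z ε n i →ₗ[Trunc O n] Trunc O n :=
  (LinearEquiv.ofInjective (LinearMap.mulLeft (Trunc O n) (eps ε n))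
      (eps_mul_injective hε n)).symm.toLinearMap ∘ₗ
    LinearMap.codRestrict _ (x O n ^ i • (Z ε n i).subtype) (fun f => by
      obtain ⟨c, hc⟩ := mem_Z.1 f.2
      exact ⟨c, hc.symm⟩)

lemma eps_mul_divEps (f : Z ε n i) : eps ε n * divEps hε n i f = x O n ^ i * (f : Trunc O n) := by
  set y := LinearMap.codRestrict (LinearMap.range (LinearMap.mulLeft (Trunc O n) (eps ε n)))
    (x O n ^ i • (Z ε n i).subtype) (fun f => by
      obtain ⟨c, hc⟩ := mem_Z.1 f.2
      exact ⟨c, hc.symm⟩) f with hy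
  have h := congrArg Subtype.val ((LinearEquiv.ofInjective (LinearMap.mulLeft (Trunc O n) (eps ε n))
      (eps_mul_injective hε n)).apply_symm_apply y)
  exact h

/-- The map `φ : Z_i → Z_i ⊆ A`, `h ↦ X^(n-1) h / ε`, for `1 ≤ i ≤ n - 1`; in terms of the basis
of `Z_i` it sends `ε` to `X^(n-1)` and every other basis element to `0`. -/
def phi : Z ε n i →ₗ[Trunc O n] Trunc O n := x O n ^ (n - 1 - i) • divEps hε n i

/-- `E_i = {(f, g, h) ∈ A ⊕ A ⊕ Z_i | π(f, g) = φ(h)}`, the pullback of `π` and `φ`. -/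
def E : Submodule (Trunc O n) ((Trunc O n × Trunc O n) × Z ε n i) :=
  LinearMap.eqLocus (proj ε n i ∘ₗ LinearMap.fst _ _ _) (phi hε n i ∘ₗ LinearMap.snd _ _ _)

/-- The map `E_i → Z_i`, `(f, g, h) ↦ h`. -/
def toZ : E hε n i →ₗ[Trunc O n] Z ε n i := LinearMap.snd _ _ _ ∘ₗ (E hε n i).subtype

/-- The map `Z_(n-i) → E_i`, `f ↦ (f, X^(n-i) f / ε, 0)`; that is, `εX^j ↦ (εX^j, X^(n-i+j), 0)`
for `0 ≤ j ≤ i - 1` and `X^j ↦ (X^j, 0, 0)` for `i ≤ j ≤ n - 1`. -/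
def fromZ : Z ε n (n - i) →ₗ[Trunc O n] E hε n i :=
  LinearMap.codRestrict _
    (((Z ε n (n - i)).subtype.prod (divEps hε n (n - i))).prod 0) (fun f => by
      have h := eps_mul_divEps hε n (n - i) f
      change x O n ^ (n - i) * (f : Trunc O n) - eps ε n * divEps hε n (n - i) f = phi hε n i 0
      rw [h, sub_self, map_zero])

/-! The map `φ` takes values in `Z_i`, and it has the stated values on the basis. -/

lemma eps_mul_phi (hi : i + 1 ≤ n) (h : Z ε n i) :
    eps ε n * phi hε n i h = x O n ^ (n - 1) * (h : Trunc O n) := by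
  have e : x O n ^ (n - 1) = x O n ^ (n - 1 - i) * x O n ^ i := by
    rw [← pow_add]; congr 1; omega
  rw [phi, LinearMap.smul_apply, smul_eq_mul, mul_left_comm, eps_mul_divEps, e, mul_assoc]

lemma phi_eps (hi : i + 1 ≤ n) : phi hε n i ⟨eps ε n, eps_mem_Z ε n i⟩ = x O n ^ (n - 1) := by
  apply eps_mul_injective hε n
  simp only [LinearMap.mulLeft_apply]
  rw [eps_mul_phi hε n i hi, mul_comm]

lemma phi_eq_zero (hi : i + 1 ≤ n) (h : Z ε n i) (hx : x O n ∣ (h : Trunc O n)) :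
    phi hε n i h = 0 := by
  obtain ⟨c, hc⟩ := hx
  apply eps_mul_injective hε n
  simp only [LinearMap.mulLeft_apply]
  rw [eps_mul_phi hε n i hi, hc, ← mul_assoc, ← pow_succ, Nat.sub_add_cancel (by omega),
    x_pow_eq_zero, zero_mul, mul_zero]

lemma phi_mem_Z (hi : 1 ≤ i) (hi' : i + 1 ≤ n) (h : Z ε n i) : phi hε n i h ∈ Z ε n i := by
  refine mem_Z.2 ⟨0, ?_⟩
  apply eps_mul_injective hε n
  simp only [LinearMap.mulLeft_apply]
  have e : x O n ^ i * x O n ^ (n - 1) = 0 := by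
    rw [← pow_add, show i + (n - 1) = n + (i - 1) by omega, pow_add, x_pow_eq_zero, zero_mul]
  rw [mul_left_comm, eps_mul_phi hε n i hi', ← mul_assoc, e, zero_mul, mul_zero, mul_zero]

end Truncated

end HellerLattice

/-! Write `zeta` for the functional h ↦ h₀/ε on Z_i, so that φ(h) = `zeta`(h) X^(n-1). Sending an
A-linear map M → A to its top coefficient identifies Hom_A(M, A) with Hom_O(M, O). Hence f : M → Z_i
lifts to E_i iff `zeta` ∘ f = α ∘ X^(n-i) + ε β for some functionals α, β on M. By duality over the
residue field this holds iff ε divides `zeta`(f m) whenever X^(n-i) m ∈ ε M (`dvd_zeta_of_lift`,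
`exists_lift`). If some m violates this, then z ↦ z m/ε is a map Z_i → M whose composite with f
sends ε to an element with unit `zeta`. Such an endomorphism of Z_i is a unit scalar plus a
nilpotent (`isUnit_end_Z`), so f is a split epimorphism. Thus the maps that lift are those that are
not split epimorphisms, and these form the radical.

For E_1, the element (1, 0, ε) spans a copy of A, split off by the first coordinate. For i ≥ 2, the
kernel of X on E_i (called the socle below) has O-rank 2 and meets every nonzero submodule. The
relations among four elements of E_i force each endomorphism to act on it, modulo ε, by a triangular
matrix with equal diagonal entries (`exists_matrix_socle`). An idempotent is therefore 0 or 1 on the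
socle, and one summand of any decomposition vanishes. -/

namespace HellerLattice

open Polynomial

/-! ### Coefficients in O[X]/(X^n), maps into A, and indecomposability of submodules of A -/

noncomputable section Coefficients

variable {O : Type u} [CommRing O]

/-- The coefficient of `X^k` of an element of `O[X]/(X^n)`. -/
def coef (O : Type u) [CommRing O] (n k : ℕ) : Trunc O n →ₗ[O] O :=
  Polynomial.lcoeff O k ∘ₗ AdjoinRoot.modByMonicHom (monic_X_pow n)

lemma coef_mk {n k : ℕ} (hk : k < n) (p : O[X]) :
    coef O n k (AdjoinRoot.mk (X ^ n : O[X]) p) = p.coeff k := by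
  have h := congrArg (fun q => Polynomial.coeff q k) (modByMonic_add_div p (X ^ n : O[X]))
  simp only [coeff_add, coeff_X_pow_mul', if_neg (not_le.2 hk), add_zero] at h
  simpa [coef] using h

lemma trunc_ext {n : ℕ} {a b : Trunc O n} (h : ∀ k < n, coef O n k a = coef O n k b) : a = b := by
  obtain ⟨p, rfl⟩ := AdjoinRoot.mk_surjective a
  obtain ⟨q, rfl⟩ := AdjoinRoot.mk_surjective b
  rw [AdjoinRoot.mk_eq_mk, X_pow_dvd_iff]
  intro k hk
  have := h k hk
  rw [coef_mk hk, coef_mk hk] at this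
  rw [coeff_sub, this, sub_self]

lemma coef_x_pow_mul {n k : ℕ} (hk : k < n) (j : ℕ) (a : Trunc O n) :
    coef O n k (x O n ^ j * a) = if j ≤ k then coef O n (k - j) a else 0 := by
  obtain ⟨p, rfl⟩ := AdjoinRoot.mk_surjective a
  rw [x, ← AdjoinRoot.mk_X, ← map_pow, ← map_mul, coef_mk hk, coeff_X_pow_mul']
  split_ifs
  · rw [coef_mk (by omega)]
  · rfl

lemma coef_x_mul {n k : ℕ} (hk : k < n) (a : Trunc O n) :
    coef O n k (x O n * a) = if 1 ≤ k then coef O n (k - 1) a else 0 := by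
  have h := coef_x_pow_mul hk 1 a
  rwa [pow_one] at h

lemma coef_x_pow {n k : ℕ} (hk : k < n) (j : ℕ) :
    coef O n k (x O n ^ j) = if k = j then 1 else 0 := by
  rw [x, ← AdjoinRoot.mk_X, ← map_pow, coef_mk hk, coeff_X_pow]

lemma eps_mul (ε : O) {n : ℕ} (a : Trunc O n) : eps ε n * a = ε • a :=
  (Algebra.smul_def ε a).symm

lemma coef_eps_mul (ε : O) {n : ℕ} (k : ℕ) (a : Trunc O n) :
    coef O n k (eps ε n * a) = ε * coef O n k a := by
  rw [eps_mul, map_smul, smul_eq_mul]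

lemma coef_eps (ε : O) {n k : ℕ} (hk : k < n) :
    coef O n k (eps ε n) = if k = 0 then ε else 0 := by
  have h := coef_eps_mul ε k (x O n ^ 0)
  rw [coef_x_pow hk] at h
  simpa using h

lemma eps_dvd_iff {ε : O} {n : ℕ} {a : Trunc O n} :
    eps ε n ∣ a ↔ ∀ k < n, ε ∣ coef O n k a := by
  constructor
  · rintro ⟨c, rfl⟩ k _
    exact ⟨_, coef_eps_mul ε k c⟩
  · intro h
    -- The guard k < n sits inside the existential so that `choose` yields a function on all of ℕ.
    have h' : ∀ k, ∃ c, k < n → coef O n k a = ε * c := fun k => by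
      by_cases hk : k < n
      · exact (h k hk).imp fun _ hc _ => hc
      · exact ⟨0, fun h => absurd h hk⟩
    choose c hc using h'
    refine ⟨∑ j ∈ Finset.range n, c j • x O n ^ j, trunc_ext fun k hk => ?_⟩
    rw [coef_eps_mul, map_sum, hc k hk]
    simp only [map_smul, coef_x_pow hk, smul_eq_mul, mul_ite, mul_one, mul_zero]
    rw [Finset.sum_ite_eq, if_pos (Finset.mem_range.2 hk)]

lemma x_pow_dvd_iff {n j : ℕ} {a : Trunc O n} :
    x O n ^ j ∣ a ↔ ∀ k < n, k < j → coef O n k a = 0 := by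
  constructor
  · rintro ⟨c, rfl⟩ k hk hj
    rw [coef_x_pow_mul hk, if_neg (not_le.2 hj)]
  · intro h
    refine ⟨∑ l ∈ Finset.range n, coef O n (l + j) a • x O n ^ l, trunc_ext fun k hk => ?_⟩
    rw [coef_x_pow_mul hk]
    split_ifs with hj
    · have hk' : k - j < n := by omega
      simp only [map_sum, map_smul, coef_x_pow hk', smul_eq_mul, mul_ite, mul_one, mul_zero]
      rw [Finset.sum_ite_eq, if_pos (Finset.mem_range.2 hk'), Nat.sub_add_cancel hj]
    · exact h k hk (not_le.1 hj)

lemma mem_Z_iff_coef {ε : O} {n i : ℕ} {a : Trunc O n} :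
    a ∈ Z ε n i ↔ ∀ k, k + i < n → ε ∣ coef O n k a := by
  rw [mem_Z, eps_dvd_iff]
  constructor
  · intro h k hk
    have := h (k + i) hk
    rwa [coef_x_pow_mul hk, if_pos (by omega), Nat.add_sub_cancel] at this
  · intro h k hk
    rw [coef_x_pow_mul hk]
    split_ifs with hi
    · exact h _ (by omega)
    · exact dvd_zero _

lemma x_pow_mem_Z (ε : O) {n i : ℕ} {j : ℕ} (hj : n ≤ i + j) : x O n ^ j ∈ Z ε n i := by
  rw [mem_Z, ← pow_add, show i + j = n + (i + j - n) by omega, pow_add, x_pow_eq_zero, zero_mul]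
  exact dvd_zero _

/-- Cut a in degree n - i: the lower part is divisible by ε, the rest by X^(n-i). So X^(n-i) and ε
generate Z_i as an ideal. -/
lemma exists_of_mem_Z {ε : O} {n i : ℕ} {a : Trunc O n} (h : a ∈ Z ε n i) :
    ∃ b c, a = x O n ^ (n - i) * b + eps ε n * c := by
  rw [mem_Z_iff_coef] at h
  set r : Trunc O n := ∑ l ∈ Finset.range (n - i), coef O n l a • x O n ^ l with hr
  have hcoef : ∀ k < n, coef O n k r = if k < n - i then coef O n k a else 0 := fun k hk => by
    simp only [hr, map_sum, map_smul, coef_x_pow hk, smul_eq_mul, mul_ite, mul_one, mul_zero]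
    rw [Finset.sum_ite_eq]
    simp
  have h1 : eps ε n ∣ r := eps_dvd_iff.2 fun k hk => by
    rw [hcoef k hk]
    split_ifs with h'
    · exact h k (by omega)
    · exact dvd_zero _
  have h2 : x O n ^ (n - i) ∣ a - r := x_pow_dvd_iff.2 fun k hk hk' => by
    rw [map_sub, hcoef k hk, if_pos hk', sub_self]
  obtain ⟨c, hc⟩ := h1
  obtain ⟨b, hb⟩ := h2
  exact ⟨b, c, by rw [← hb, ← hc, sub_add_cancel]⟩

/-- An `O`-linear map that commutes with the action of `X` is linear over `O[X]/(X^n)`. -/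
def truncLinear {n : ℕ} {M N : Type*} [AddCommGroup M] [Module O M] [Module (Trunc O n) M]
    [IsScalarTower O (Trunc O n) M] [AddCommGroup N] [Module O N] [Module (Trunc O n) N]
    [IsScalarTower O (Trunc O n) N] (f : M →ₗ[O] N) (hf : ∀ m, f (x O n • m) = x O n • f m) :
    M →ₗ[Trunc O n] N where
  toFun := f
  map_add' := f.map_add
  map_smul' a m := by
    obtain ⟨p, rfl⟩ := AdjoinRoot.mk_surjective a
    simp only [RingHom.id_apply]
    induction p using Polynomial.induction_on' generalizing m with
    | add p q hp hq => rw [map_add, add_smul, add_smul, map_add, hp, hq]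
    | monomial k c =>
      rw [← C_mul_X_pow_eq_monomial, map_mul, map_pow, AdjoinRoot.mk_X, AdjoinRoot.mk_C]
      induction k generalizing m with
      | zero =>
        rw [pow_zero, mul_one, ← AdjoinRoot.algebraMap_eq, algebraMap_smul, algebraMap_smul,
          map_smul]
      | succ k ih => rw [pow_succ, ← mul_assoc, mul_smul _ _ m, mul_smul _ _ (f m), ih, hf]

/-- The `A`-linear map `M → A` attached to a functional `α` on `M`: its top coefficient is `α`. -/
def ofFunctional {n : ℕ} {M : Type*} [AddCommGroup M] [Module O M] [Module (Trunc O n) M]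
    [IsScalarTower O (Trunc O n) M] (α : M →ₗ[O] O) : M →ₗ[Trunc O n] Trunc O n :=
  have : SMulCommClass (Trunc O n) O M := IsScalarTower.to_smulCommClass'
  truncLinear (∑ k ∈ Finset.range n,
      (α ∘ₗ Module.toModuleEnd O (S := Trunc O n) M (x O n ^ (n - 1 - k))).smulRight (x O n ^ k))
    (fun m => trunc_ext fun k hk => by
      rw [smul_eq_mul, coef_x_mul hk]
      have key : ∀ j < n, ∀ m : M, coef O n j ((∑ k ∈ Finset.range n,
          (α ∘ₗ Module.toModuleEnd O (S := Trunc O n) M (x O n ^ (n - 1 - k))).smulRight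
            (x O n ^ k)) m) = α (x O n ^ (n - 1 - j) • m) := fun j hj m => by
        simp only [LinearMap.sum_apply, LinearMap.smulRight_apply, LinearMap.comp_apply, map_sum,
          map_smul, coef_x_pow hj, smul_eq_mul, mul_ite, mul_one, mul_zero]
        rw [Finset.sum_ite_eq, if_pos (Finset.mem_range.2 hj)]
        rfl
      -- Multiplying m by X raises the exponent n-1-k by one, which is the shift k ↦ k-1; for k = 0
      -- the exponent becomes n and the term dies.
      rw [key k hk, smul_smul, ← pow_succ]
      split_ifs with h
      · rw [key (k - 1) (by omega)]
        congr 3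
        omega
      · rw [show n - 1 - k + 1 = n by omega, x_pow_eq_zero, zero_smul, map_zero])

lemma coef_ofFunctional {n : ℕ} {M : Type*} [AddCommGroup M] [Module O M] [Module (Trunc O n) M]
    [IsScalarTower O (Trunc O n) M] (α : M →ₗ[O] O) {j : ℕ} (hj : j < n) (m : M) :
    coef O n j (ofFunctional α m) = α (x O n ^ (n - 1 - j) • m) := by
  have : SMulCommClass (Trunc O n) O M := IsScalarTower.to_smulCommClass'
  change coef O n j ((∑ k ∈ Finset.range n,
    (α ∘ₗ Module.toModuleEnd O (S := Trunc O n) M (x O n ^ (n - 1 - k))).smulRight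
      (x O n ^ k)) m) = _
  simp only [LinearMap.sum_apply, LinearMap.smulRight_apply, LinearMap.comp_apply, map_sum,
    map_smul, coef_x_pow hj, smul_eq_mul, mul_ite, mul_one, mul_zero]
  rw [Finset.sum_ite_eq, if_pos (Finset.mem_range.2 hj)]
  rfl

/-- An `A`-linear map to `A` is determined by its top coefficient. -/
lemma hom_ext_top {n : ℕ} {M : Type*} [AddCommGroup M] [Module (Trunc O n) M]
    {f g : M →ₗ[Trunc O n] Trunc O n}
    (h : ∀ m, coef O n (n - 1) (f m) = coef O n (n - 1) (g m)) : f = g := by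
  ext m
  refine trunc_ext fun k hk => ?_
  -- Multiplication by X^(n-1-k) moves the coefficient in degree k to the top.
  have := h (x O n ^ (n - 1 - k) • m)
  rwa [f.map_smul, g.map_smul, smul_eq_mul, smul_eq_mul, coef_x_pow_mul (by omega),
    coef_x_pow_mul (by omega), if_pos (by omega), if_pos (by omega),
    show n - 1 - (n - 1 - k) = k by omega] at this

/-- X is nilpotent, so there is a last nonzero X^k m. Consequently every nonzero submodule meets the
kernel of X. -/
lemma exists_ne_zero_smul_eq_zero {n : ℕ} {M : Type*} [AddCommGroup M] [Module (Trunc O n) M]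
    {m : M} (hm : m ≠ 0) : ∃ k, x O n ^ k • m ≠ 0 ∧ x O n • x O n ^ k • m = 0 := by
  classical
  have hex : ∃ k, x O n ^ k • m = 0 := ⟨n, by rw [x_pow_eq_zero, zero_smul]⟩
  obtain ⟨k, hk⟩ : ∃ k, Nat.find hex = k + 1 := Nat.exists_eq_succ_of_ne_zero fun h0 => hm <| by
    have := Nat.find_spec hex
    rwa [h0, pow_zero, one_smul] at this
  refine ⟨k, Nat.find_min hex (by omega), ?_⟩
  have := Nat.find_spec hex
  rwa [hk, pow_succ', mul_smul] at this

lemma eq_smul_of_x_mul_eq_zero {n : ℕ} {a : Trunc O n} (h : x O n * a = 0) :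
    a = coef O n (n - 1) a • x O n ^ (n - 1) := by
  refine trunc_ext fun k hk => ?_
  rw [map_smul, coef_x_pow hk, smul_eq_mul, mul_ite, mul_one, mul_zero]
  split_ifs with hk'
  · rw [hk']
  · have := congrArg (coef O n (k + 1)) h
    rw [coef_x_mul (by omega), if_pos (by omega), map_zero] at this
    simpa using this

/-- Every nonzero submodule of `A` meets `O X^(n-1)`; hence these submodules are indecomposable. -/
lemma isIndecomposable_submodule [IsDomain O] {n : ℕ} (N : Submodule (Trunc O n) (Trunc O n))
    (hN : Nontrivial N) : IsIndecomposable (Trunc O n) N := by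
  have key : ∀ P : Submodule (Trunc O n) N, P ≠ ⊥ →
      ∃ p ∈ P, ∃ c : O, c ≠ 0 ∧ (p : Trunc O n) = c • x O n ^ (n - 1) := by
    intro P hP
    obtain ⟨p, hp, hp0⟩ := P.ne_bot_iff.1 hP
    obtain ⟨k, hk, hk'⟩ := exists_ne_zero_smul_eq_zero (O := O) (n := n) hp0
    have hpk := eq_smul_of_x_mul_eq_zero (a := ((x O n ^ k • p : N) : Trunc O n))
      (congrArg Subtype.val hk')
    refine ⟨_, P.smul_mem (x O n ^ k) hp, _, fun h0 => hk (Subtype.ext ?_), hpk⟩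
    rw [h0, zero_smul] at hpk
    exact hpk
  refine ⟨hN, fun P Q hPQ => ?_⟩
  by_contra! h
  obtain ⟨p, hp, c, hc, hpc⟩ := key P h.1
  obtain ⟨q, hq, d, hd, hqd⟩ := key Q h.2
  -- With p = c X^(n-1) ∈ P and q = d X^(n-1) ∈ Q, the element cd X^(n-1) lies in both summands.
  have e : eps d n • p = eps c n • q := Subtype.ext <| by
    simp only [Submodule.coe_smul, smul_eq_mul, eps_mul, hpc, hqd, smul_smul, mul_comm c d]
  have h0 : eps d n • p = 0 := by
    have := Submodule.disjoint_def.1 hPQ.disjoint _ (P.smul_mem (eps d n) hp)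
      (e ▸ Q.smul_mem (eps c n) hq)
    exact this
  have h1 := congrArg (fun z : N => coef O n (n - 1) z) h0
  have hn : n - 1 < n := by
    rcases Nat.eq_zero_or_pos n with rfl | h
    · obtain ⟨a, b, hab⟩ := hN
      exact absurd (Subtype.ext (trunc_ext fun k hk => absurd hk (by omega))) hab
    · omega
  simp only [Submodule.coe_smul, smul_eq_mul, eps_mul, hpc, map_smul, coef_x_pow hn,
    if_true, ZeroMemClass.coe_zero, map_zero, mul_one] at h1
  exact (mul_ne_zero hd hc) h1

lemma IsIndecomposable.of_equiv {A M N : Type*} [Ring A] [AddCommGroup M] [Module A M]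
    [AddCommGroup N] [Module A N] (e : M ≃ₗ[A] N) (h : IsIndecomposable A M) :
    IsIndecomposable A N := by
  refine ⟨have := h.nontrivial; e.symm.toEquiv.nontrivial, fun P Q hPQ => ?_⟩
  have := (Submodule.orderIsoMapComap e.symm).isCompl hPQ
  exact (h.eq_bot_or_eq_bot _ _ this).imp (fun h => (Submodule.map_eq_bot_iff (e := e.symm)).1 h)
    (fun h => (Submodule.map_eq_bot_iff (e := e.symm)).1 h)

lemma isIndecomposable_trunc [IsDomain O] {n : ℕ} (hn : 1 ≤ n) :
    IsIndecomposable (Trunc O n) (Trunc O n) := by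
  have : Nontrivial (Trunc O n) := ⟨⟨x O n ^ 0, 0, fun h => by
    have := congrArg (coef O n 0) h
    rw [coef_x_pow hn, if_pos rfl, map_zero] at this
    exact one_ne_zero this⟩⟩
  exact (isIndecomposable_submodule ⊤ Submodule.topEquiv.toEquiv.nontrivial).of_equiv
    Submodule.topEquiv

lemma isIndecomposable_Z [IsDomain O] {ε : O} (hε : Irreducible ε) {n i : ℕ} (hn : 1 ≤ n) :
    IsIndecomposable (Trunc O n) (Z ε n i) := by
  refine isIndecomposable_submodule _ ⟨⟨⟨eps ε n, eps_mem_Z ε n i⟩, 0, fun h => hε.ne_zero ?_⟩⟩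
  have := congrArg (fun z : Z ε n i => coef O n 0 z) h
  simpa [coef_eps ε hn] using this

lemma isLattice_of_injective [IsDomain O] [IsPrincipalIdealRing O] {M N : Type*} [AddCommGroup M]
    [Module O M] [AddCommGroup N] [Module O N] (hN : IsLattice O N) (f : M →ₗ[O] N)
    (hf : Function.Injective f) : IsLattice O M := by
  have := hN.free
  have := hN.finite
  have : Module.Finite O M := Module.Finite.of_injective f hf
  have : Module.IsTorsionFree O M := hf.moduleIsTorsionFree f (map_smul f)
  exact ⟨Module.free_of_finite_type_torsion_free', inferInstance⟩

lemma isLattice_trunc (n : ℕ) : IsLattice O (Trunc O n) :=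
  ⟨(monic_X_pow n).free_adjoinRoot, (monic_X_pow n).finite_adjoinRoot⟩

lemma isLattice_Z [IsDomain O] [IsPrincipalIdealRing O] (ε : O) (n i : ℕ) :
    IsLattice O (Z ε n i) :=
  isLattice_of_injective (isLattice_trunc n) ((Z ε n i).subtype.restrictScalars O)
    Subtype.val_injective

lemma isLattice_E [IsDomain O] [IsPrincipalIdealRing O] {ε : O} (hε : Irreducible ε) (n i : ℕ) :
    IsLattice O (E hε n i) := by
  have h1 := isLattice_trunc (O := O) n
  have h2 := isLattice_Z ε n i
  have := h1.free
  have := h1.finite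
  have := h2.free
  have := h2.finite
  exact isLattice_of_injective (N := (Trunc O n × Trunc O n) × Z ε n i)
    ⟨inferInstance, inferInstance⟩ ((E hε n i).subtype.restrictScalars O) Subtype.val_injective

end Coefficients

/-! ### The lifting criterion and the almost split property -/

noncomputable section AlmostSplit

variable {O : Type u} [CommRing O]

/-- A functional `α` on a free module `M` that vanishes modulo a maximal ideal `(ε)` wherever
`T` does, factors through `T` modulo `ε`. -/
lemma exists_functional_comp_add {M : Type*} [AddCommGroup M] [Module O M] [Module.Free O M]
    {ε : O} (hε : (Ideal.span {ε}).IsMaximal) (T : M →ₗ[O] M) (f : M →ₗ[O] O)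
    (h : ∀ m m', T m = ε • m' → ε ∣ f m) :
    ∃ α : M →ₗ[O] O, ∀ m, ε ∣ f m - α (T m) := by
  let I := Ideal.span {ε}
  let := Ideal.Quotient.field I
  let V := M ⧸ (I • ⊤ : Submodule O M)
  have hsurj : Function.Surjective (algebraMap O (O ⧸ I)) := Ideal.Quotient.mk_surjective
  have hmem : ∀ m : M, m ∈ (I • ⊤ : Submodule O M) ↔ ∃ m', m = ε • m' := fun m => by
    rw [Submodule.ideal_span_singleton_smul, Submodule.mem_smul_pointwise_iff_exists]
    exact ⟨fun ⟨a, _, ha⟩ => ⟨a, ha.symm⟩, fun ⟨a, ha⟩ => ⟨a, trivial, ha.symm⟩⟩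
  let T' : V →ₗ[O] V := Submodule.mapQ _ _ T fun m hm => by
    obtain ⟨m', rfl⟩ := (hmem m).1 hm
    exact (hmem _).2 ⟨T m', map_smul _ _ _⟩
  let f' : V →ₗ[O] O ⧸ I := Submodule.liftQ _ (I.mkQ ∘ₗ f) fun m hm => by
    obtain ⟨m', rfl⟩ := (hmem m).1 hm
    rw [LinearMap.mem_ker, LinearMap.comp_apply, Submodule.mkQ_apply,
      Submodule.Quotient.mk_eq_zero, map_smul, smul_eq_mul]
    exact Ideal.mem_span_singleton.2 (dvd_mul_right _ _)
  let T'' : V →ₗ[O ⧸ I] V := LinearMap.extendScalarsOfSurjective hsurj T'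
  let f'' : Module.Dual (O ⧸ I) V := LinearMap.extendScalarsOfSurjective hsurj f'
  -- Over the field O/ε, a functional killing the kernel of T lies in the image of the transpose of
  -- T.
  have hf : f'' ∈ (LinearMap.ker T'').dualAnnihilator := by
    rw [Submodule.mem_dualAnnihilator]
    intro v hv
    obtain ⟨m, rfl⟩ := Submodule.mkQ_surjective _ v
    have hm : T m ∈ (I • ⊤ : Submodule O M) := (Submodule.Quotient.mk_eq_zero _).1 hv
    obtain ⟨m', hm'⟩ := (hmem _).1 hm
    exact (Submodule.Quotient.mk_eq_zero I).2 (Ideal.mem_span_singleton.2 (h m m' hm'))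
  rw [← LinearMap.range_dualMap_eq_dualAnnihilator_ker] at hf
  obtain ⟨α', hα'⟩ := hf
  -- Freeness of M lifts the functional from O/ε back to O.
  obtain ⟨α, hα⟩ := Module.projective_lifting_property I.mkQ
    ((α'.restrictScalars O) ∘ₗ Submodule.mkQ (I • ⊤ : Submodule O M)) (Submodule.mkQ_surjective I)
  refine ⟨α, fun m => Ideal.mem_span_singleton.1 ((Submodule.Quotient.eq I).1 ?_)⟩
  have h1 := LinearMap.congr_fun hα (T m)
  have h2 := LinearMap.congr_fun hα' (Submodule.mkQ _ m)
  exact h2.symm.trans h1.symm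

/-- This puts ε under the divisibility test for lifts, which is what prevents the identity of Z_i
from lifting. -/
lemma x_pow_smul_eps {ε : O} {n i : ℕ} :
    x O n ^ (n - i) • (⟨eps ε n, eps_mem_Z ε n i⟩ : Z ε n i) =
      ε • ⟨x O n ^ (n - i), x_pow_mem_Z ε (by omega)⟩ := by
  refine Subtype.ext ?_
  change x O n ^ (n - i) * eps ε n = ε • x O n ^ (n - i)
  rw [mul_comm, eps_mul]

variable [IsDomain O] {ε : O} (hε : Irreducible ε) (n i : ℕ)

/-- The functional `h ↦ h₀ / ε` on `Z_i`, where `h₀` is the constant coefficient of `h`. -/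
def zeta : Z ε n i →ₗ[O] O := coef O n i ∘ₗ (divEps hε n i).restrictScalars O

variable {n i}

lemma eps_mul_zeta (hi : i < n) (h : Z ε n i) : ε * zeta hε n i h = coef O n 0 h := by
  have := congrArg (coef O n i) (eps_mul_divEps hε n i h)
  rwa [coef_eps_mul, coef_x_pow_mul hi, if_pos le_rfl, Nat.sub_self] at this

lemma zeta_eps (hi : i < n) : zeta hε n i ⟨eps ε n, eps_mem_Z ε n i⟩ = 1 := by
  have := eps_mul_zeta hε hi ⟨eps ε n, eps_mem_Z ε n i⟩
  rw [coef_eps ε (by omega), if_pos rfl] at this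
  exact mul_left_cancel₀ hε.ne_zero (by rw [this, mul_one])

lemma phi_eq_zeta_smul (hi : i < n) (h : Z ε n i) :
    phi hε n i h = zeta hε n i h • x O n ^ (n - 1) := by
  apply eps_mul_injective hε n
  simp only [LinearMap.mulLeft_apply]
  rw [eps_mul_phi hε n i hi]
  refine trunc_ext fun k hk => ?_
  rw [coef_x_pow_mul hk, coef_eps_mul, map_smul, coef_x_pow hk, smul_eq_mul]
  by_cases hk' : k = n - 1
  · rw [if_pos (by omega), if_pos hk', mul_one, eps_mul_zeta hε hi, hk', Nat.sub_self]
  · rw [if_neg (by omega), if_neg hk', mul_zero, mul_zero]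

lemma mem_E (hi : i < n) {v : (Trunc O n × Trunc O n) × Z ε n i} :
    v ∈ E hε n i ↔
      x O n ^ (n - i) * v.1.1 - eps ε n * v.1.2 = zeta hε n i v.2 • x O n ^ (n - 1) := by
  rw [← phi_eq_zeta_smul hε hi]
  exact Iff.rfl

lemma fromZ_injective : Function.Injective (fromZ hε n i) := fun _ _ h =>
  Subtype.ext (congrArg (fun v : E hε n i => v.1.1.1) h)

lemma exact_fromZ_toZ : Function.Exact (fromZ hε n i) (toZ hε n i) := by
  rintro ⟨⟨⟨f, g⟩, h⟩, hv⟩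
  constructor
  · rintro (rfl : h = 0)
    have hv' : x O n ^ (n - i) * f - eps ε n * g = phi hε n i 0 := hv
    rw [map_zero, sub_eq_zero] at hv'
    refine ⟨⟨f, mem_Z.2 ⟨g, hv'⟩⟩, Subtype.ext (Prod.ext (Prod.ext rfl ?_) rfl)⟩
    apply eps_mul_injective hε n
    exact (eps_mul_divEps hε n (n - i) ⟨f, mem_Z.2 ⟨g, hv'⟩⟩).trans hv'
  · rintro ⟨a, ha⟩
    rw [← ha]
    rfl

lemma toZ_surjective (hi : 1 ≤ i) (hi' : i < n) : Function.Surjective (toZ hε n i) := by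
  intro h
  -- X^(n-i) X^(i-1) = X^(n-1), so this first coordinate alone produces φ(h).
  refine ⟨⟨((zeta hε n i h • x O n ^ (i - 1), 0), h), (mem_E hε hi').2 ?_⟩, rfl⟩
  rw [mul_zero, sub_zero, mul_smul_comm, ← pow_add, show n - i + (i - 1) = n - 1 by omega]

section Lift

variable {M : Type*} [AddCommGroup M] [Module O M] [Module (Trunc O n) M]
  [IsScalarTower O (Trunc O n) M]

/-- Both terms on the left of the pullback equation at q(m) are divisible by ε, and `zeta` is the
top coefficient of the right side. -/
lemma dvd_zeta_of_lift (hi : i < n) (q : M →ₗ[Trunc O n] E hε n i) {m m' : M}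
    (hm : x O n ^ (n - i) • m = ε • m') : ε ∣ zeta hε n i (toZ hε n i (q m)) := by
  have h1 := (mem_E hε hi).1 (q m).2
  have h2 : x O n ^ (n - i) * (q m).1.1.1 = eps ε n * (q m').1.1.1 := by
    rw [← algebraMap_smul (Trunc O n) ε m'] at hm
    have h := congrArg q hm
    rw [map_smul, map_smul] at h
    exact congrArg (fun v : E hε n i => v.1.1.1) h
  rw [h2, ← mul_sub] at h1
  have h3 := congrArg (coef O n (n - 1)) h1
  rw [coef_eps_mul, map_smul, coef_x_pow (by omega), if_pos rfl, smul_eq_mul, mul_one] at h3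
  exact ⟨_, h3.symm⟩

/-- Converse of `dvd_zeta_of_lift`: the hypothesis gives `zeta` ∘ f = α ∘ X^(n-i) + ε β, and the
maps M → A with top coefficients α and -β are the first two coordinates of the lift. -/
lemma exists_lift (hM : IsLattice O M) (hmax : (Ideal.span {ε}).IsMaximal) (hi : i < n)
    (f : M →ₗ[Trunc O n] Z ε n i)
    (h : ∀ m m', x O n ^ (n - i) • m = ε • m' → ε ∣ zeta hε n i (f m)) :
    ∃ q : M →ₗ[Trunc O n] E hε n i, toZ hε n i ∘ₗ q = f := by
  have := hM.free
  have : SMulCommClass (Trunc O n) O M := IsScalarTower.to_smulCommClass'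
  obtain ⟨α, hα⟩ := exists_functional_comp_add hmax
    (Module.toModuleEnd O (S := Trunc O n) M (x O n ^ (n - i)))
    (zeta hε n i ∘ₗ f.restrictScalars O) h
  choose β' hβ' using hα
  -- The quotient by ε is unique in a domain, so the chosen values are automatically linear.
  let β : M →ₗ[O] O :=
    { toFun := β'
      map_add' := fun a b => mul_left_cancel₀ hε.ne_zero <| by
        rw [mul_add, ← hβ', ← hβ', ← hβ']
        simp only [map_add]
        ring
      map_smul' := fun c a => mul_left_cancel₀ hε.ne_zero <| by
        rw [RingHom.id_apply, smul_eq_mul, mul_left_comm, ← hβ', ← hβ']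
        simp only [map_smul, smul_eq_mul]
        ring }
  have key : proj ε n i ∘ₗ ((ofFunctional α).prod (ofFunctional (-β))) = phi hε n i ∘ₗ f := by
    refine hom_ext_top fun m => ?_
    have h1 := hβ' m
    change zeta hε n i (f m) - α (x O n ^ (n - i) • m) = ε * β m at h1
    change coef O n (n - 1) (x O n ^ (n - i) * ofFunctional α m - eps ε n * ofFunctional (-β) m)
      = coef O n (n - 1) (phi hε n i (f m))
    have e : ∀ γ : M →ₗ[O] O, coef O n (n - 1) (ofFunctional γ m) = γ m := fun γ => by
      rw [coef_ofFunctional γ (by omega), Nat.sub_self, pow_zero, one_smul]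
    rw [phi_eq_zeta_smul hε hi, map_sub, coef_eps_mul, map_smul, coef_x_pow (by omega), if_pos rfl,
      smul_eq_mul, mul_one, ← smul_eq_mul (x O n ^ (n - i)), ← (ofFunctional α).map_smul,
      coef_ofFunctional α (by omega), Nat.sub_self, pow_zero, one_smul, e, LinearMap.neg_apply]
    linear_combination -h1
  refine ⟨LinearMap.codRestrict _ (((ofFunctional α).prod (ofFunctional (-β))).prod f)
    fun m => LinearMap.congr_fun key m, rfl⟩

/-- An element `m` with `X^(n-i) m ∈ ε M` gives the map `Z_i → M`, `z ↦ z m / ε`. -/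
lemma exists_hom_of_dvd (hε : Irreducible ε) (hM : IsLattice O M) {m m' : M}
    (hm : x O n ^ (n - i) • m = ε • m') :
    ∃ s : Z ε n i →ₗ[Trunc O n] M, s ⟨eps ε n, eps_mem_Z ε n i⟩ = m := by
  have := hM.free
  have hinj : Function.Injective fun m : M => ε • m := smul_right_injective M hε.ne_zero
  have hex : ∀ z : Z ε n i, ∃ m'' : M, ε • m'' = (z : Trunc O n) • m := fun z => by
    obtain ⟨b, c, hbc⟩ := exists_of_mem_Z z.2
    -- For z = X^(n-i) b + ε c, the product z m equals ε (b m' + c m). Linearity of the quotient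
    -- follows since ε acts injectively on M.
    refine ⟨b • m' + c • m, ?_⟩
    rw [hbc, add_smul, mul_comm, mul_smul, hm, mul_smul, smul_add]
    simp only [← algebraMap_smul (Trunc O n) ε, smul_smul, mul_comm]
  choose s hs using hex
  refine ⟨{ toFun := s, map_add' := fun a b => hinj ?_, map_smul' := fun a b => hinj ?_ },
    hinj ?_⟩
  · change ε • s (a + b) = ε • (s a + s b)
    rw [smul_add, hs, hs, hs, Submodule.coe_add, add_smul]
  · change ε • s (a • b) = ε • (a • s b)
    rw [hs, ← algebraMap_smul (Trunc O n) ε (a • s b), smul_comm,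
      algebraMap_smul (Trunc O n) ε, hs, Submodule.coe_smul, smul_smul, smul_eq_mul]
  · change ε • s _ = ε • m
    rw [hs, algebraMap_smul]

end Lift

/-- Let c be the given unit. Then (ψ - c)(ε) has zero constant coefficient, so X divides it in A;
this makes ψ - c nilpotent, and ψ is a unit plus a commuting nilpotent. -/
lemma isUnit_end_Z (hi : i < n) (ψ : Module.End (Trunc O n) (Z ε n i))
    (h : IsUnit (zeta hε n i (ψ ⟨eps ε n, eps_mem_Z ε n i⟩))) : IsUnit ψ := by
  set e : Z ε n i := ⟨eps ε n, eps_mem_Z ε n i⟩ with he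
  set c := zeta hε n i (ψ e) with hc
  set u : Module.End (Trunc O n) (Z ε n i) := algebraMap (Trunc O n) _ (eps c n) with hu
  have huu : IsUnit u := (h.map (algebraMap O (Trunc O n))).map _
  have hcomm : Commute (ψ - u) u := (Algebra.commutes _ _).symm
  suffices IsNilpotent (ψ - u) by
    have := this.isUnit_add_left_of_commute huu hcomm
    rwa [add_sub_cancel] at this
  have hdvd : x O n ∣ ((ψ - u) e : Trunc O n) := by
    rw [← pow_one (x O n), x_pow_dvd_iff]
    intro k hk hk'
    obtain rfl : k = 0 := by omega
    rw [LinearMap.sub_apply, AddSubgroupClass.coe_sub, map_sub, ← eps_mul_zeta hε hi, ← hc, hu,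
      Module.algebraMap_end_apply, Submodule.coe_smul, smul_eq_mul, he, coef_eps_mul,
      coef_eps ε hk, if_pos rfl, mul_comm, sub_self]
  -- Since ε z = z · ε with the second ε viewed in Z_i, ψ - u is multiplication by (ψ - u)(ε)/ε;
  -- here the denominators are cleared.
  have hpow : ∀ (k : ℕ) (z : Z ε n i),
      eps ε n ^ k * (((ψ - u) ^ k) z : Trunc O n) = ((ψ - u) e : Trunc O n) ^ k * z := by
    intro k
    induction k with
    | zero => intro z; simp
    | succ k ih =>
      intro z
      have h1 : eps ε n * ((ψ - u) z : Trunc O n) = ((ψ - u) e : Trunc O n) * z := by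
        have h2 : eps ε n • z = (z : Trunc O n) • e := Subtype.ext (mul_comm _ _)
        have := congrArg (fun z => ((ψ - u) z : Trunc O n)) h2
        simp only [map_smul, Submodule.coe_smul, smul_eq_mul] at this
        rw [this, mul_comm]
      rw [pow_succ (ψ - u), Module.End.mul_apply, pow_succ, mul_right_comm, ih, mul_right_comm,
        mul_assoc, h1, pow_succ, mul_assoc]
  refine ⟨n, LinearMap.ext fun z => Subtype.ext ?_⟩
  have h1 := hpow n z
  obtain ⟨d, hd⟩ := hdvd
  rw [hd, mul_pow, x_pow_eq_zero, zero_mul, zero_mul, ← map_pow, ← Algebra.smul_def] at h1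
  have := (isLattice_trunc (O := O) n).free
  exact smul_right_injective (Trunc O n) (pow_ne_zero n hε.ne_zero) (by simpa using h1)

/-- `f : M → Z_i` either lifts to `E_i` or is a split epimorphism. -/
lemma exists_lift_or_exists_section [IsDiscreteValuationRing O] {M : Type*} [AddCommGroup M]
    [Module O M] [Module (Trunc O n) M] [IsScalarTower O (Trunc O n) M] (hM : IsLattice O M)
    (hi : i < n) (f : M →ₗ[Trunc O n] Z ε n i) :
    (∃ q : M →ₗ[Trunc O n] E hε n i, toZ hε n i ∘ₗ q = f) ∨
      ∃ s : Z ε n i →ₗ[Trunc O n] M, f ∘ₗ s = LinearMap.id := by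
  have hspan := hε.maximalIdeal_eq
  refine or_iff_not_imp_left.2 fun hq => ?_
  have hmax : (Ideal.span {ε}).IsMaximal := by
    rw [← hspan]
    infer_instance
  obtain ⟨m, m', hm, hndvd⟩ : ∃ m m', x O n ^ (n - i) • m = ε • m' ∧ ¬ ε ∣ zeta hε n i (f m) := by
    by_contra! h
    exact hq (exists_lift hε hM hmax hi f h)
  obtain ⟨s, hs⟩ := exists_hom_of_dvd hε hM hm
  have hu : IsUnit (zeta hε n i (f m)) := by
    by_contra hu
    rw [← mem_nonunits_iff, ← IsLocalRing.mem_maximalIdeal, hspan,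
      Ideal.mem_span_singleton] at hu
    exact hndvd hu
  rw [← hs] at hu
  obtain ⟨ψ, hψ⟩ := isUnit_end_Z hε hi (f ∘ₗ s) hu
  refine ⟨s ∘ₗ ((ψ⁻¹ : (Module.End (Trunc O n) (Z ε n i))ˣ) : Module.End (Trunc O n) (Z ε n i)), ?_⟩
  rw [← LinearMap.comp_assoc, ← hψ]
  exact ψ.mul_inv

/-- At ε, the functional `zeta` of 1 - p q is 1 minus a multiple of ε, hence a unit. -/
lemma isUnit_one_sub_of_lift [IsDiscreteValuationRing O] (hi : i < n)
    (q : Z ε n i →ₗ[Trunc O n] E hε n i) :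
    IsUnit (1 - toZ hε n i ∘ₗ q : Module.End (Trunc O n) (Z ε n i)) := by
  refine isUnit_end_Z hε hi _ ?_
  rw [LinearMap.sub_apply, Module.End.one_apply, map_sub, zeta_eps hε hi]
  refine (IsLocalRing.isUnit_or_isUnit_one_sub_self _).resolve_left fun hu => ?_
  exact hε.not_isUnit (isUnit_of_dvd_unit (dvd_zeta_of_lift hε hi q x_pow_smul_eps) hu)

lemma not_section [IsDiscreteValuationRing O] (hi : i < n) :
    ¬ ∃ s : Z ε n i →ₗ[Trunc O n] E hε n i, toZ hε n i ∘ₗ s = LinearMap.id := by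
  rintro ⟨s, hs⟩
  have h := isUnit_one_sub_of_lift hε hi s
  have := (isIndecomposable_Z (i := i) hε (Nat.lt_of_le_of_lt (Nat.zero_le i) hi)).nontrivial
  rw [hs, ← Module.End.one_eq_id, sub_self] at h
  exact not_isUnit_zero h

/-- If `1 - b a` is invertible for all `a`, then `b` composed with anything is in the radical. -/
lemma comp_mem_jacobson {A M N : Type*} [Ring A] [AddCommGroup M] [Module A M] [AddCommGroup N]
    [Module A N] (b : M →ₗ[A] N) (a : N →ₗ[A] M)
    (h : ∀ a : N →ₗ[A] M, IsUnit (1 - b ∘ₗ a : Module.End A N)) :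
    (a ∘ₗ b : Module.End A M) ∈ Ring.jacobson (Module.End A M) := by
  rw [← Ideal.jacobson_bot, Ideal.mem_jacobson_iff]
  intro y
  obtain ⟨v, hv⟩ := (h (-(y ∘ₗ a))).exists_left_inv
  -- The identity (1 + st)⁻¹ = 1 - s (1 + ts)⁻¹ t with s = y a and t = b.
  refine ⟨1 - y ∘ₗ a ∘ₗ v ∘ₗ b, ?_⟩
  rw [Submodule.mem_bot]
  ext m
  have h1 : v (b m + b (y (a (b m)))) = b m := by
    have := LinearMap.congr_fun hv (b m)
    simpa using this
  have h2 := congrArg (fun z => y (a z)) h1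
  simp only [map_add] at h2
  simp only [LinearMap.sub_apply, LinearMap.add_apply, Module.End.mul_apply, Module.End.one_apply,
    LinearMap.comp_apply, LinearMap.zero_apply]
  refine Eq.trans ?_ (neg_eq_zero.2 (sub_eq_zero.2 h2))
  abel

lemma isAlmostSplit [IsDiscreteValuationRing O] (hi : 1 ≤ i) (hi' : i < n) :
    IsAlmostSplit O (Trunc O n) (fromZ hε n i) (toZ hε n i) where
  lattice_left := isLattice_Z ε n _
  lattice_middle := isLattice_E hε n i
  lattice_right := isLattice_Z ε n i
  injective := fromZ_injective hε
  exact := exact_fromZ_toZ hε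
  surjective := toZ_surjective hε hi hi'
  not_split := not_section hε hi'
  indec_left := isIndecomposable_Z hε (by omega)
  indec_right := isIndecomposable_Z hε (by omega)
  range_eq_radical X _ _ _ _ hX _ f := by
    constructor
    · rintro ⟨q, rfl⟩ Y _ _ _ _ _ _ g h
      refine comp_mem_jacobson ((toZ hε n i ∘ₗ q) ∘ₗ g) h fun a => ?_
      exact isUnit_one_sub_of_lift hε hi' (q ∘ₗ g ∘ₗ a)
    · intro hf
      refine (exists_lift_or_exists_section hε hX hi' f).resolve_right ?_
      -- If f were radical and split by s, the identity f s of Z_i would lie in the Jacobson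
      -- radical.
      rintro ⟨s, hs⟩
      have hZ := isIndecomposable_Z (i := i) hε (show 1 ≤ n by omega)
      have := hZ.nontrivial
      have h := hf (Z ε n i) (isLattice_Z ε n i) hZ s LinearMap.id
      rw [hs, LinearMap.id_comp, ← Module.End.one_eq_id, ← Ideal.jacobson_bot] at h
      exact bot_ne_top (Ideal.jacobson_eq_top_iff.1 ((Ideal.eq_top_iff_one _).2 h))

end AlmostSplit

/-! ### Decomposition of the middle term -/

noncomputable section MiddleTerm

variable {O : Type u} [CommRing O] [IsDomain O] {ε : O} (hε : Irreducible ε) (n i : ℕ)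

/-- The map `E_i → A`, `(f, g, h) ↦ f`. -/
def toFst : E hε n i →ₗ[Trunc O n] Trunc O n :=
  LinearMap.fst _ _ _ ∘ₗ LinearMap.fst _ _ _ ∘ₗ (E hε n i).subtype

/-- The map `E_i → A`, `(f, g, h) ↦ h`. -/
def toSnd : E hε n i →ₗ[Trunc O n] Trunc O n := (Z ε n i).subtype ∘ₗ toZ hε n i

/-- The regular module is a direct summand of `E_1`, generated by `(1, 0, ε)`. -/
lemma exists_isCompl_equiv (hn : 2 ≤ n) :
    ∃ P Q : Submodule (Trunc O n) (E hε n 1),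
      IsCompl P Q ∧ Nonempty (P ≃ₗ[Trunc O n] Trunc O n) := by
  let v : E hε n 1 := ⟨((1, 0), ⟨eps ε n, eps_mem_Z ε n 1⟩), (mem_E hε (by omega)).2 <| by
    rw [zeta_eps hε (by omega), mul_one, mul_zero, sub_zero, one_smul]⟩
  let s : Trunc O n →ₗ[Trunc O n] E hε n 1 := LinearMap.toSpanSingleton _ _ v
  have hs : ∀ a, toFst hε n 1 (s a) = a := fun a => mul_one a
  have hinj : Function.Injective s := Function.LeftInverse.injective hs
  -- The first coordinate is a retraction of s, so its kernel is a complement of the copy of A.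
  refine ⟨LinearMap.range s, LinearMap.ker (s.rangeRestrict ∘ₗ toFst hε n 1),
    LinearMap.isCompl_of_proj ?_, ⟨(LinearEquiv.ofInjective s hinj).symm⟩⟩
  rintro ⟨_, a, rfl⟩
  refine Subtype.ext ?_
  change s (toFst hε n 1 (s a)) = s a
  rw [hs]

variable {n i}

/-- The middle coordinate g is recovered from ε g = X^(n-i) f - φ(h), so E_i embeds in A ⊕ A through
f and h. -/
lemma E_ext (hi : i < n) {v w : E hε n i} (h1 : toFst hε n i v = toFst hε n i w)
    (h2 : toSnd hε n i v = toSnd hε n i w) : v = w := by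
  have h2' : v.1.2 = w.1.2 := Subtype.ext h2
  have hv := (mem_E hε hi).1 v.2
  have hw := (mem_E hε hi).1 w.2
  change v.1.1.1 = w.1.1.1 at h1
  refine Subtype.ext (Prod.ext (Prod.ext h1 (eps_mul_injective hε n ?_)) h2')
  rw [h1, h2', ← hw] at hv
  exact sub_right_injective hv

/-- Coefficient j + (n-i) of the pullback equation, read modulo ε; it is the top one exactly for j =
i-1. This is the link between the coordinates f and h. -/
lemma dvd_coef_toFst (hi : i < n) (v : E hε n i) {j : ℕ} (hj : j < i) :
    ε ∣ coef O n j (toFst hε n i v) - if j = i - 1 then zeta hε n i (toZ hε n i v) else 0 := by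
  have h := congrArg (coef O n (j + (n - i))) ((mem_E hε hi).1 v.2)
  rw [map_sub, coef_eps_mul, coef_x_pow_mul (by omega), if_pos (by omega), Nat.add_sub_cancel,
    map_smul, coef_x_pow (by omega), smul_eq_mul, mul_ite, mul_one, mul_zero] at h
  refine ⟨coef O n (j + (n - i)) v.1.1.2, ?_⟩
  have e : (j + (n - i) = n - 1) ↔ (j = i - 1) := by omega
  simp only [e] at h
  exact sub_eq_iff_eq_add.2 ((sub_eq_iff_eq_add.1 h).trans (add_comm _ _))

/-- The element `(X^(n-1), 0, 0)` of `E_i`. -/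
def socleFst (hi : 1 ≤ i) (hi' : i < n) : E hε n i :=
  ⟨((x O n ^ (n - 1), 0), 0), (mem_E hε hi').2 <| by
    rw [← pow_add, show n - i + (n - 1) = n + (n - i - 1) by omega, pow_add, x_pow_eq_zero,
      zero_mul, mul_zero, sub_zero, map_zero, zero_smul]⟩

/-- The element `(0, 0, X^(n-1))` of `E_i`. -/
def socleSnd (hi : 1 ≤ i) (hi' : i < n) : E hε n i :=
  ⟨((0, 0), ⟨x O n ^ (n - 1), x_pow_mem_Z ε (by omega)⟩), (mem_E hε hi').2 <| by
    rw [← phi_eq_zeta_smul hε hi', phi_eq_zero hε n i hi' _ (dvd_pow_self _ (by omega)),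
      mul_zero, mul_zero, sub_zero]⟩

lemma coef_toFst_socle (hi : 1 ≤ i) (hi' : i < n) (a b : O) :
    coef O n (n - 1) (toFst hε n i (a • socleFst hε hi hi' + b • socleSnd hε hi hi')) = a := by
  change coef O n (n - 1) (a • x O n ^ (n - 1) + b • 0) = a
  rw [smul_zero, add_zero, map_smul, coef_x_pow (by omega), if_pos rfl, smul_eq_mul, mul_one]

lemma coef_toSnd_socle (hi : 1 ≤ i) (hi' : i < n) (a b : O) :
    coef O n (n - 1) (toSnd hε n i (a • socleFst hε hi hi' + b • socleSnd hε hi hi')) = b := by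
  change coef O n (n - 1) (a • 0 + b • x O n ^ (n - 1)) = b
  rw [smul_zero, zero_add, map_smul, coef_x_pow (by omega), if_pos rfl, smul_eq_mul, mul_one]

lemma eq_socle_of_x_smul_eq_zero (hi : 1 ≤ i) (hi' : i < n) {v : E hε n i}
    (h : x O n • v = 0) :
    v = coef O n (n - 1) (toFst hε n i v) • socleFst hε hi hi' +
      coef O n (n - 1) (toSnd hε n i v) • socleSnd hε hi hi' := by
  have h1 := congrArg (toFst hε n i) h
  have h2 := congrArg (toSnd hε n i) h
  rw [map_smul, map_zero] at h1 h2
  refine E_ext hε hi' ((eq_smul_of_x_mul_eq_zero h1).trans ?_)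
    ((eq_smul_of_x_mul_eq_zero h2).trans ?_)
  · change _ = coef O n (n - 1) (toFst hε n i v) • x O n ^ (n - 1) +
      coef O n (n - 1) (toSnd hε n i v) • 0
    rw [smul_zero, add_zero]
  · change _ = coef O n (n - 1) (toFst hε n i v) • 0 +
      coef O n (n - 1) (toSnd hε n i v) • x O n ^ (n - 1)
    rw [smul_zero, zero_add]

lemma x_smul_socleFst (hi : 1 ≤ i) (hi' : i < n) : x O n • socleFst hε hi hi' = 0 := by
  refine E_ext hε hi' ?_ (mul_zero (x O n))
  change x O n * x O n ^ (n - 1) = 0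
  rw [← pow_succ', Nat.sub_add_cancel (by omega), x_pow_eq_zero]

lemma x_smul_socleSnd (hi : 1 ≤ i) (hi' : i < n) : x O n • socleSnd hε hi hi' = 0 := by
  refine E_ext hε hi' (mul_zero (x O n)) ?_
  change x O n * x O n ^ (n - 1) = 0
  rw [← pow_succ', Nat.sub_add_cancel (by omega), x_pow_eq_zero]

/-- An endomorphism of `E_i` acts on the socle, modulo `ε`, by a triangular matrix with equal
diagonal entries. -/
lemma exists_matrix_socle (hi : 2 ≤ i) (hi' : i < n) (e : Module.End (Trunc O n) (E hε n i)) :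
    ∃ a b c d : O,
      e (socleFst hε (by omega) hi') =
        a • socleFst hε (by omega) hi' + c • socleSnd hε (by omega) hi' ∧
      e (socleSnd hε (by omega) hi') =
        b • socleFst hε (by omega) hi' + d • socleSnd hε (by omega) hi' ∧
      ε ∣ a - d ∧ (ε ∣ b ∨ ε ∣ c) := by
  have hi1 : 1 ≤ i := by omega
  have hxn : ∀ k, n ≤ k → x O n ^ k = 0 := fun k hk => by
    rw [← Nat.add_sub_cancel' hk, pow_add, x_pow_eq_zero, zero_mul]
  -- Here w and v are the images of X^i, ε ∈ Z_(n-i), while y and u lift X^(n-i), ε ∈ Z_i. The socle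
  -- elements are multiples of w and y, and the relations `hv`, `hu`, `hw0`, `hy0` constrain the
  -- matrix entries.
  let w : E hε n i := ⟨((x O n ^ i, 0), 0), (mem_E hε hi').2 <| by
    rw [← pow_add, hxn _ (by omega), mul_zero, sub_zero, map_zero, zero_smul]⟩
  let y : E hε n i := ⟨((0, 0), ⟨x O n ^ (n - i), x_pow_mem_Z ε (by omega)⟩),
    (mem_E hε hi').2 <| by
      rw [← phi_eq_zeta_smul hε hi', phi_eq_zero hε n i hi' _ (dvd_pow_self _ (by omega)),
        mul_zero, mul_zero, sub_zero]⟩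
  let v : E hε n i := ⟨((eps ε n, x O n ^ (n - i)), 0), (mem_E hε hi').2 <| by
    rw [mul_comm, sub_self, map_zero, zero_smul]⟩
  let u : E hε n i := ⟨((x O n ^ (i - 1), 0), ⟨eps ε n, eps_mem_Z ε n i⟩), (mem_E hε hi').2 <| by
    rw [← pow_add, mul_zero, sub_zero, zeta_eps hε hi', one_smul]
    congr 1
    omega⟩
  have hw : socleFst hε hi1 hi' = x O n ^ (n - 1 - i) • w := by
    refine E_ext hε hi' ?_ (mul_zero (x O n ^ (n - 1 - i))).symm
    change x O n ^ (n - 1) = x O n ^ (n - 1 - i) * x O n ^ i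
    rw [← pow_add]
    congr 1
    omega
  have hy : socleSnd hε hi1 hi' = x O n ^ (i - 1) • y := by
    refine E_ext hε hi' (mul_zero (x O n ^ (i - 1))).symm ?_
    change x O n ^ (n - 1) = x O n ^ (i - 1) * x O n ^ (n - i)
    rw [← pow_add]
    congr 1
    omega
  have hv : x O n ^ i • v = eps ε n • w := by
    refine E_ext hε hi' (mul_comm (x O n ^ i) (eps ε n)) ?_
    change x O n ^ i * 0 = eps ε n * 0
    rw [mul_zero, mul_zero]
  have hu : x O n ^ (n - i) • u = x O n ^ (n - i - 1) • w + eps ε n • y := by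
    refine E_ext hε hi' ?_ ?_
    · change x O n ^ (n - i) * x O n ^ (i - 1) = x O n ^ (n - i - 1) * x O n ^ i + eps ε n * 0
      rw [← pow_add, ← pow_add, mul_zero, add_zero]
      congr 1
      omega
    · change x O n ^ (n - i) * eps ε n = x O n ^ (n - i - 1) * 0 + eps ε n * x O n ^ (n - i)
      rw [mul_zero, zero_add, mul_comm]
  have hw0 : x O n ^ (n - i) • w = 0 := by
    refine E_ext hε hi' ?_ (mul_zero (x O n ^ (n - i)))
    change x O n ^ (n - i) * x O n ^ i = 0
    rw [← pow_add, hxn _ (by omega)]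
  have hy0 : x O n ^ i • y = 0 := by
    refine E_ext hε hi' (mul_zero (x O n ^ i)) ?_
    change x O n ^ i * x O n ^ (n - i) = 0
    rw [← pow_add, hxn _ (by omega)]
  set F := toFst hε n i ∘ₗ e
  set H := toSnd hε n i ∘ₗ e
  have hz : ∀ z : E hε n i, ε * zeta hε n i (toZ hε n i (e z)) = coef O n 0 (H z) :=
    fun z => eps_mul_zeta hε hi' _
  have hd : ∀ (z : E hε n i) {j : ℕ}, j < i → ε ∣ coef O n j (F z) -
      if j = i - 1 then zeta hε n i (toZ hε n i (e z)) else 0 :=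
    fun z _ hj => dvd_coef_toFst hε hi' (e z) hj
  refine ⟨coef O n i (F w), coef O n (n - i) (F y), coef O n i (H w), coef O n (n - i) (H y),
    ?_, ?_, ?_, ?_⟩
  · have h0 : x O n • e (socleFst hε hi1 hi') = 0 := by
      rw [← map_smul, x_smul_socleFst, map_zero]
    refine (eq_socle_of_x_smul_eq_zero hε hi1 hi' h0).trans ?_
    have h1 : ∀ G : E hε n i →ₗ[Trunc O n] Trunc O n,
        coef O n (n - 1) (G (socleFst hε hi1 hi')) = coef O n i (G w) := fun G => by
      rw [hw, G.map_smul, smul_eq_mul, coef_x_pow_mul (by omega), if_pos (by omega)]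
      congr 2
      omega
    exact congrArg₂ (fun a c => a • socleFst hε hi1 hi' + c • socleSnd hε hi1 hi') (h1 F) (h1 H)
  · have h0 : x O n • e (socleSnd hε hi1 hi') = 0 := by
      rw [← map_smul, x_smul_socleSnd, map_zero]
    refine (eq_socle_of_x_smul_eq_zero hε hi1 hi' h0).trans ?_
    have h1 : ∀ G : E hε n i →ₗ[Trunc O n] Trunc O n,
        coef O n (n - 1) (G (socleSnd hε hi1 hi')) = coef O n (n - i) (G y) := fun G => by
      rw [hy, G.map_smul, smul_eq_mul, coef_x_pow_mul (by omega), if_pos (by omega)]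
      congr 2
      omega
    exact congrArg₂ (fun a c => a • socleFst hε hi1 hi' + c • socleSnd hε hi1 hi') (h1 F) (h1 H)
  -- The relation for u gives a modulo ε as the coefficient of F u in degree i-1, and d as `zeta` of
  -- e u; `dvd_coef_toFst` compares them. The second value needs the coefficient of H w in degree 1
  -- to vanish, which is read off in degree n-i+1, below n because i ≥ 2.
  · have hFu := congrArg (fun z => coef O n (n - 1) (F z)) hu
    have hHu := congrArg (fun z => coef O n (n - i) (H z)) hu
    have hHw := congrArg (fun z => coef O n (n - i + 1) (H z)) hw0
    simp only [map_add, F.map_smul, H.map_smul, smul_eq_mul, coef_eps_mul, map_zero] at hFu hHu hHw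
    rw [coef_x_pow_mul (by omega), if_pos (by omega), coef_x_pow_mul (by omega),
      if_pos (by omega), show n - 1 - (n - i) = i - 1 by omega,
      show n - 1 - (n - i - 1) = i by omega] at hFu
    rw [coef_x_pow_mul (by omega), if_pos (by omega), Nat.add_sub_cancel_left] at hHw
    rw [coef_x_pow_mul (by omega), if_pos (by omega), coef_x_pow_mul (by omega),
      if_pos (by omega), Nat.sub_self, show n - i - (n - i - 1) = 1 by omega, hHw, zero_add,
      ← hz] at hHu
    have h1 := mul_left_cancel₀ hε.ne_zero hHu
    have h2 := hd u (j := i - 1) (by omega)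
    rw [if_pos rfl, hFu, h1, add_sub_right_comm] at h2
    exact (dvd_add_left (dvd_mul_right _ _)).1 h2
  -- If 2i ≤ n, the relation X^i v = ε w yields c = `zeta`(e v) ≡ 0. Otherwise n-i < i, and X^i y =
  -- 0 forces `zeta`(e y) = 0, so `dvd_coef_toFst` in degree n-i gives b ≡ 0.
  · by_cases hni : 2 * i ≤ n
    · right
      have hFv := congrArg (fun z => coef O n (2 * i - 1) (F z)) hv
      have hHv := congrArg (fun z => coef O n i (H z)) hv
      simp only [F.map_smul, H.map_smul, smul_eq_mul, coef_eps_mul] at hFv hHv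
      rw [coef_x_pow_mul (by omega), if_pos (by omega), show 2 * i - 1 - i = i - 1 by omega] at hFv
      rw [coef_x_pow_mul (by omega), if_pos le_rfl, Nat.sub_self, ← hz] at hHv
      have h1 := mul_left_cancel₀ hε.ne_zero hHv
      have h2 := hd v (j := i - 1) (by omega)
      rw [if_pos rfl, hFv, h1] at h2
      exact (dvd_sub_right (dvd_mul_right _ _)).1 h2
    · left
      have hHy := congrArg (fun z => coef O n i (H z)) hy0
      simp only [H.map_smul, smul_eq_mul, map_zero] at hHy
      rw [coef_x_pow_mul (by omega), if_pos le_rfl, Nat.sub_self, ← hz] at hHy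
      have h1 := (mul_eq_zero.1 hHy).resolve_left hε.ne_zero
      have h2 := hd y (j := n - i) (by omega)
      rwa [h1, ite_self, sub_zero] at h2

/-- An idempotent `2 × 2` matrix that is triangular modulo `ε` with equal diagonal entries modulo
`ε` is trivial. -/
lemma idempotent_matrix_trivial [IsDiscreteValuationRing O] {a b c d : O} (h1 : a * a + b * c = a)
    (h2 : a * b + b * d = b) (h3 : c * a + d * c = c) (h4 : c * b + d * d = d) (had : ε ∣ a - d)
    (hbc : ε ∣ b ∨ ε ∣ c) (hε : Irreducible ε) :
    (a = 0 ∧ b = 0 ∧ c = 0 ∧ d = 0) ∨ (a = 1 ∧ b = 0 ∧ c = 0 ∧ d = 1) := by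
  have hp : Prime ε := hε.prime
  have hbc' : ε ∣ b * c := hbc.elim (fun h => h.mul_right c) fun h => h.mul_left b
  have hne : ∀ t : O, ε ∣ t → 1 - t ≠ 0 := fun t ht h0 =>
    hp.not_isUnit (isUnit_of_dvd_one (by rwa [← sub_eq_zero.1 h0] at ht))
  -- Modulo ε the product bc vanishes, so a is 0 or 1 there, and d agrees with a. If both are 0,
  -- then 1 - (a + d) is nonzero and kills b and c; if both are 1, the same holds for the
  -- complementary idempotent.
  have ha : ε ∣ a * (1 - a) := by
    rwa [show a * (1 - a) = b * c by linear_combination -h1]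
  rcases hp.dvd_or_dvd ha with ha | ha
  · left
    have hd : ε ∣ d := by simpa using dvd_sub ha had
    have hs := hne (a + d) (dvd_add ha hd)
    have hb : b = 0 := (mul_eq_zero.1 (show b * (1 - (a + d)) = 0 by
      linear_combination -h2)).resolve_right hs
    have hc : c = 0 := (mul_eq_zero.1 (show c * (1 - (a + d)) = 0 by
      linear_combination -h3)).resolve_right hs
    subst hb hc
    exact ⟨(mul_eq_zero.1 (show a * (1 - a) = 0 by linear_combination -h1)).resolve_right (hne a ha),
      rfl, rfl,
      (mul_eq_zero.1 (show d * (1 - d) = 0 by linear_combination -h4)).resolve_right (hne d hd)⟩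
  · right
    have hd : ε ∣ 1 - d := by simpa using dvd_add ha had
    have hs := hne ((1 - a) + (1 - d)) (dvd_add ha hd)
    have hb : b = 0 := (mul_eq_zero.1 (show b * (1 - ((1 - a) + (1 - d))) = 0 by
      linear_combination h2)).resolve_right hs
    have hc : c = 0 := (mul_eq_zero.1 (show c * (1 - ((1 - a) + (1 - d))) = 0 by
      linear_combination h3)).resolve_right hs
    subst hb hc
    have h1' := (mul_eq_zero.1 (show (1 - a) * (1 - (1 - a)) = 0 by
      linear_combination -h1)).resolve_right (hne _ ha)
    have h4' := (mul_eq_zero.1 (show (1 - d) * (1 - (1 - d)) = 0 by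
      linear_combination -h4)).resolve_right (hne _ hd)
    exact ⟨(sub_eq_zero.1 h1').symm, rfl, rfl, (sub_eq_zero.1 h4').symm⟩

/-- An idempotent endomorphism of `E_i` is zero or the identity on the socle. -/
lemma idempotent_socle_trivial [IsDiscreteValuationRing O] (hi : 2 ≤ i) (hi' : i < n)
    (e : Module.End (Trunc O n) (E hε n i)) (he : IsIdempotentElem e) :
    (∀ v, x O n • v = 0 → e v = 0) ∨ (∀ v, x O n • v = 0 → e v = v) := by
  have hi1 : 1 ≤ i := by omega
  obtain ⟨a, b, c, d, h1, h2, had, hbc⟩ := exists_matrix_socle hε hi hi' e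
  set s := socleFst hε hi1 hi' with hs
  set t := socleSnd hε hi1 hi' with ht
  have hlin : ∀ p q : O, e (p • s + q • t) = (p * a + q * b) • s + (p * c + q * d) • t := by
    intro p q
    rw [map_add, LinearMap.map_smul_of_tower, LinearMap.map_smul_of_tower, h1, h2]
    module
  have hcmp : ∀ p q p' q' : O, p • s + q • t = p' • s + q' • t → p = p' ∧ q = q' := by
    intro p q p' q' h
    constructor
    · have := congrArg (fun z => coef O n (n - 1) (toFst hε n i z)) h
      rwa [hs, ht, coef_toFst_socle, coef_toFst_socle] at this
    · have := congrArg (fun z => coef O n (n - 1) (toSnd hε n i z)) h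
      rwa [hs, ht, coef_toSnd_socle, coef_toSnd_socle] at this
  have hee : ∀ z, e (e z) = e z := fun z => LinearMap.congr_fun he z
  have h3 := hee s
  have h4 := hee t
  rw [h1, hlin] at h3
  rw [h2, hlin] at h4
  obtain ⟨h5, h6⟩ := hcmp _ _ _ _ h3
  obtain ⟨h7, h8⟩ := hcmp _ _ _ _ h4
  have hsoc := fun v (hv : x O n • v = 0) => eq_socle_of_x_smul_eq_zero hε hi1 hi' hv
  rcases idempotent_matrix_trivial (a := a) (b := b) (c := c) (d := d)
    (by linear_combination h5) (by linear_combination h7) (by linear_combination h6)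
    (by linear_combination h8) had hbc hε with ⟨rfl, rfl, rfl, rfl⟩ | ⟨rfl, rfl, rfl, rfl⟩
  · left
    intro v hv
    rw [hsoc v hv, ← hs, ← ht, hlin]
    module
  · right
    intro v hv
    rw [hsoc v hv, ← hs, ← ht, hlin]
    module

/-- The projection onto P along Q is 0 or 1 on the socle, so P or Q contains no nonzero socle
element and is therefore zero. -/
lemma isIndecomposable_E [IsDiscreteValuationRing O] (hi : 2 ≤ i) (hi' : i < n) :
    IsIndecomposable (Trunc O n) (E hε n i) := by
  have hi1 : 1 ≤ i := by omega
  refine ⟨⟨⟨socleFst hε hi1 hi', 0, fun h => ?_⟩⟩, fun P Q hPQ => ?_⟩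
  · have h1 := coef_toFst_socle hε hi1 hi' 1 0
    rw [h, smul_zero, zero_smul, add_zero, map_zero, map_zero] at h1
    exact zero_ne_one h1
  · have hbot : ∀ N : Submodule (Trunc O n) (E hε n i),
        (∀ v ∈ N, x O n • v = 0 → v = 0) → N = ⊥ := by
      intro N hN
      refine (Submodule.eq_bot_iff N).2 fun v hv => ?_
      by_contra hv0
      obtain ⟨k, hk, hk'⟩ := exists_ne_zero_smul_eq_zero (O := O) (n := n) hv0
      exact hk (hN _ (N.smul_mem _ hv) hk')
    refine (idempotent_socle_trivial hε hi hi' (P.projection Q hPQ)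
      (Submodule.isIdempotentElem_projection hPQ)).imp (fun h => ?_) (fun h => ?_)
    · refine hbot P fun v hv hxv => ?_
      rw [← h v hxv, Submodule.projection_apply_of_mem_left hPQ hv]
    · refine hbot Q fun v hv hxv => ?_
      rw [← h v hxv, Submodule.projection_apply_eq_zero_iff hPQ]
      exact hv

end MiddleTerm

end HellerLattice

theorem mainTheorem4 {O : Type u} [CommRing O] [IsDomain O] [IsDiscreteValuationRing O]
    [IsAdicComplete (IsLocalRing.maximalIdeal O) O] (ε : O) (hε : Irreducible ε)
    (n : ℕ) (hn : 2 ≤ n) :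
    (∀ i : ℕ, 1 ≤ i → i ≤ n - 1 →
      HellerLattice.IsAlmostSplit O (HellerLattice.Trunc O n)
        (HellerLattice.fromZ hε n i) (HellerLattice.toZ hε n i)) ∧
    (HellerLattice.IsIndecomposable (HellerLattice.Trunc O n) (HellerLattice.Trunc O n) ∧
      ∃ P Q : Submodule (HellerLattice.Trunc O n) (HellerLattice.E hε n 1),
        IsCompl P Q ∧ Nonempty (P ≃ₗ[HellerLattice.Trunc O n] HellerLattice.Trunc O n)) ∧
    (∀ i : ℕ, 2 ≤ i → i ≤ n - 1 →
      HellerLattice.IsLattice O (HellerLattice.E hε n i) ∧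
      HellerLattice.IsIndecomposable (HellerLattice.Trunc O n) (HellerLattice.E hε n i)) :=
  ⟨fun _ hi hi' => HellerLattice.isAlmostSplit hε hi (by omega),
    ⟨HellerLattice.isIndecomposable_trunc (by omega),
      HellerLattice.exists_isCompl_equiv hε n hn⟩,
    fun i hi hi' => ⟨HellerLattice.isLattice_E hε n i,
      HellerLattice.isIndecomposable_E hε hi (by omega)⟩⟩
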